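/- Let $V$ be a finite set and let $F$ be a set of subsets (hyperedges) of $V$. Let $G$ be the region graph on $R=\{\{s\}: s\in V\}\cup F$: two distinct regions are adjacent when one is included in the other (edge directions are disregarded). Suppose we are in the Bethe case, that is, $G$ has two layers: whenever $r,s\in R$ and $r\subsetneq s$, the region $r$ is a singleton. For $F'\subseteq F$ let $N(F')$ be the set of all $r\in R$ such that $r\subseteq\alpha$ or $\alpha\subseteq r$ for some $\alpha\in F'$. A graph is called a single-cycle forest if each of its connected components contains at most one cycle. Define $$\mathbb{F}=\{1_{F'} : F'\subseteq F \text{ and the subgraph of } G \text{ induced by } F'\cup N(F') \text{ is a single-cycle forest}\}\subseteq\{0,1\}^F,$$ where $1_{F'}\in\{0,1\}^F$ is the indicator vector of $F'$, and $$\mathbb{C}=\Big\{\rho\in[0,1]^F : \sum_{\alpha\in F:\ \alpha\cap U\ne\emptyset}(|\alpha\cap U|-1)\,\rho_\alpha\le |U| \ \text{ for all } U\subseteq V\Big\}.$$ Then $\operatorname{conv}(\mathbb{F})\subseteq\mathbb{C}$. If in addition $|\alpha|=2$ for all $\alpha\in F$, then $\operatorname{conv}(\mathbb{F})=\mathbb{C}$.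 -/

import Mathlib

/-- The region graph on a collection `R` of subsets of `V`, with edge directions disregarded:
distinct regions are joined when one is included in the other. -/
def regionGraph {V : Type*} (R : Finset (Finset V)) : SimpleGraph {r // r ∈ R} where
  Adj r s := r.1 ⊂ s.1 ∨ s.1 ⊂ r.1
  symm := ⟨fun _ _ h => h.symm⟩
  loopless := ⟨fun _ h => h.elim (fun h => h.ne rfl) (fun h => h.ne rfl)⟩

/-- `N(r)`: the regions of `R` that contain `r` or are contained in `r`. -/
def regionNbhd {V : Type*} [DecidableEq V] (R : Finset (Finset V)) (r : Finset V) :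
    Finset (Finset V) :=
  R.filter fun s => r ⊆ s ∨ s ⊆ r

/-- `N(R')`, the union of the sets `N(r)` over `r ∈ R'`. -/
def regionNbhdSet {V : Type*} [DecidableEq V] (R R' : Finset (Finset V)) :
    Finset (Finset V) :=
  R'.biUnion (regionNbhd R)

/-- The regions `V ∪ F`: all singletons of `V`, together with the hyperedges in `F`. -/
def betheRegions {V : Type*} [Fintype V] [DecidableEq V] (F : Finset (Finset V)) :
    Finset (Finset V) :=
  Finset.univ.image (fun v : V => ({v} : Finset V)) ∪ F

/-- The Bethe case: the region graph on `V ∪ F` has two layers, i.e. a region can be strictly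
included in another region only if it is a single vertex. -/
def IsBethe {V : Type*} [Fintype V] [DecidableEq V] (F : Finset (Finset V)) : Prop :=
  ∀ r ∈ betheRegions F, ∀ s ∈ betheRegions F, r ⊂ s → r.card = 1

/-- `H` is a cycle of `G`, regarded as a subgraph (no base point and no orientation). -/
def IsCycleSubgraph {W : Type*} {G : SimpleGraph W} (H : G.Subgraph) : Prop :=
  ∃ (u : W) (p : G.Walk u u), p.IsCycle ∧ p.toSubgraph = H

/-- Every connected component contains at most one cycle. -/
def IsSingleCycleForest {W : Type*} (G : SimpleGraph W) : Prop :=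
  ∀ c : G.ConnectedComponent,
    {H : G.Subgraph | IsCycleSubgraph H ∧ H.verts ⊆ c.supp}.Subsingleton

/-- The indicator vector `1_{F'}` in `ℝ^F`. -/
def hyperedgeIndicator {V : Type*} [DecidableEq V] (F F' : Finset (Finset V)) :
    {α // α ∈ F} → ℝ :=
  fun α => if α.1 ∈ F' then 1 else 0

/-- The set `𝔽` of the vectors `1_{F'}`, `F' ⊆ F`, for which the subgraph of the region graph
induced by `F' ∪ N(F')` is a single-cycle forest. -/
def singleCycleForestVectors {V : Type*} [Fintype V] [DecidableEq V] (F : Finset (Finset V)) :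
    Set ({α // α ∈ F} → ℝ) :=
  {x | ∃ F' : Finset (Finset V), F' ⊆ F ∧
    IsSingleCycleForest ((regionGraph (betheRegions F)).induce
      {r | r.1 ∈ F' ∪ regionNbhdSet (betheRegions F) F'}) ∧
    x = hyperedgeIndicator F F'}

/-- The polytope of concavity `ℂ`. -/
def concavityPolytope {V : Type*} [DecidableEq V] (F : Finset (Finset V)) :
    Set ({α // α ∈ F} → ℝ) :=
  {ρ | (∀ α, ρ α ∈ Set.Icc (0 : ℝ) 1) ∧
    ∀ U : Finset V,
      ∑ α : {α // α ∈ F} with (α.1 ∩ U).Nonempty, (((α.1 ∩ U).card : ℝ) - 1) * ρ α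
        ≤ (U.card : ℝ)}

/-! A finite single-cycle forest has at most as many edges as vertices. Applied to the incidence
graph between vertices of `U` and the chosen hyperedges that meet `U`, this bound is exactly the
inequality of ℂ at an indicator vector. Since ℂ is convex, it contains the hull.

When all hyperedges have size 2, the inequalities of ℂ become a fractional Hall condition: the
weight of any set of edges is at most the number of vertices it covers. So the weight of each edge
can be split between its two ends with no vertex receiving more than 1. Completing this splitting to
a doubly stochastic matrix, Birkhoff's theorem writes it as a mixture of permutations. Each
permutation selects a set of edges with distinct representative ends, and such a set induces a
single-cycle forest. Hall's theorem is applied to integer multiplicities ⌊ρN⌋, and a limit N → ∞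
recovers ρ because the hull of a finite set is closed. -/

/-! ### Single-cycle forests and edge counting -/

theorem SimpleGraph.Subgraph.map_injective_of_injective {W W' : Type*} {G : SimpleGraph W}
    {G' : SimpleGraph W'} {f : G →g G'} (hf : Function.Injective f) :
    Function.Injective (SimpleGraph.Subgraph.map f) := by
  intro A B h
  ext a b
  · have := congrArg (fun H : G'.Subgraph => f a ∈ H.verts) h
    simpa [hf.eq_iff] using this
  · have := congrArg (fun H : G'.Subgraph => H.Adj (f a) (f b)) h
    simpa [Relation.map_apply, hf.eq_iff] using this

/-- A cycle, as a subgraph, is determined by its edges. -/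
theorem SimpleGraph.Walk.IsCycle.toSubgraph_eq_of_edges {W : Type*} {G : SimpleGraph W} {u v : W}
    {p : G.Walk u u} {q : G.Walk v v} (hp : p.IsCycle) (hq : q.IsCycle)
    (h : ∀ e, e ∈ p.edges ↔ e ∈ q.edges) : p.toSubgraph = q.toSubgraph := by
  ext a b
  · rw [mem_verts_toSubgraph, mem_verts_toSubgraph,
      mem_support_iff_exists_mem_edges_of_not_nil hp.not_nil,
      mem_support_iff_exists_mem_edges_of_not_nil hq.not_nil]
    simp only [h]
  · rw [← Subgraph.mem_edgeSet, ← Subgraph.mem_edgeSet, mem_edges_toSubgraph,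
      mem_edges_toSubgraph, h]

theorem IsSingleCycleForest.comap {W W' : Type*} {G : SimpleGraph W} {G' : SimpleGraph W'}
    (h : IsSingleCycleForest G') (f : G →g G') (hf : Function.Injective f) :
    IsSingleCycleForest G := by
  rintro c _ ⟨⟨u, p, hp, rfl⟩, hpc⟩ _ ⟨⟨v, q, hq, rfl⟩, hqc⟩
  apply SimpleGraph.Subgraph.map_injective_of_injective hf
  rw [← SimpleGraph.Walk.toSubgraph_map, ← SimpleGraph.Walk.toSubgraph_map]
  have key : ∀ (w : W) (r : G.Walk w w), r.toSubgraph.verts ⊆ c.supp →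
      (r.map f).toSubgraph.verts ⊆ (c.map f).supp := by
    intro w r hr x hx
    rw [SimpleGraph.Walk.toSubgraph_map] at hx
    obtain ⟨y, hy, rfl⟩ := hx
    have := hr hy
    rw [SimpleGraph.ConnectedComponent.mem_supp_iff] at this ⊢
    rw [← this]
    rfl
  exact h (c.map f) ⟨⟨_, _, hp.map hf, rfl⟩, key _ _ hpc⟩ ⟨⟨_, _, hq.map hf, rfl⟩, key _ _ hqc⟩

/-- Removing a bridge increases the number of connected components. -/
theorem SimpleGraph.card_connectedComponent_lt_of_isBridge {W : Type*} [Finite W]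
    {G : SimpleGraph W} {u v : W} (huv : G.Adj u v) (h : G.IsBridge s(u, v)) :
    Nat.card G.ConnectedComponent < Nat.card (G.deleteEdges {s(u, v)}).ConnectedComponent := by
  have := Fintype.ofFinite G.ConnectedComponent
  have := Fintype.ofFinite (G.deleteEdges {s(u, v)}).ConnectedComponent
  rw [Nat.card_eq_fintype_card, Nat.card_eq_fintype_card]
  refine Fintype.card_lt_of_surjective_not_injective
    (ConnectedComponent.map (Hom.ofLE (G.deleteEdges_le {s(u, v)}))) ?_ ?_
  · intro c
    induction c using ConnectedComponent.ind with
    | h w => exact ⟨(G.deleteEdges {s(u, v)}).connectedComponentMk w, rfl⟩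
  · intro hinj
    rw [isBridge_iff] at h
    apply h
    rw [← ConnectedComponent.eq]
    apply hinj
    simp only [ConnectedComponent.map_mk]
    exact ConnectedComponent.eq.2 huv.reachable

/-- Every edge of a forest is a bridge, so deleting edges one by one gains a component each time,
and there are never more components than vertices. -/
theorem SimpleGraph.IsAcyclic.card_edgeSet_add_card_connectedComponent_le {W : Type*} [Finite W]
    {G : SimpleGraph W} (h : G.IsAcyclic) :
    Nat.card G.edgeSet + Nat.card G.ConnectedComponent ≤ Nat.card W := by
  induction hn : Nat.card G.edgeSet generalizing G with
  | zero =>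
    rw [zero_add]
    exact Nat.card_le_card_of_surjective G.connectedComponentMk Quot.mk_surjective
  | succ n ih =>
    have hne : Nonempty G.edgeSet := (Nat.card_pos_iff.1 (by omega)).1
    obtain ⟨⟨e, he⟩⟩ := hne
    induction e using Sym2.ind with
    | h u v =>
    have hb := isAcyclic_iff_forall_isBridge.1 h he
    have hlt := card_connectedComponent_lt_of_isBridge (u := u) (v := v) he hb
    have := ih (G := G.deleteEdges {s(u, v)}) (h.anti (G.deleteEdges_le _)) (by
      rw [Nat.card_coe_set_eq] at hn ⊢
      rw [edgeSet_deleteEdges, Set.ncard_sdiff_singleton_of_mem he, hn]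
      rfl)
    omega

/-- Deleting one edge from the cycle of each component leaves a forest. At most one edge per
component is lost, and the forest bound has room for one extra edge per component. -/
theorem IsSingleCycleForest.card_edgeSet_le {W : Type*} [Finite W] {G : SimpleGraph W}
    (h : IsSingleCycleForest G) : Nat.card G.edgeSet ≤ Nat.card W := by
  classical
  have hsub : ∀ (u v : W) (p : G.Walk u u) (q : G.Walk v v), p.IsCycle → q.IsCycle →
      G.connectedComponentMk u = G.connectedComponentMk v → p.toSubgraph = q.toSubgraph := by
    intro u v p q hp hq huv
    have key : ∀ (w : W) (r : G.Walk w w), r.toSubgraph.verts ⊆ (G.connectedComponentMk w).supp := by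
      intro w r x hx
      rw [SimpleGraph.Walk.mem_verts_toSubgraph] at hx
      exact SimpleGraph.ConnectedComponent.eq.2 (r.takeUntil x hx).reachable.symm
    exact h (G.connectedComponentMk u) ⟨⟨_, _, hp, rfl⟩, key _ _⟩
      ⟨⟨_, _, hq, rfl⟩, huv ▸ key _ _⟩
  -- `S` holds one edge of the cycle of `c`, or nothing if `c` has no cycle.
  have hch : ∀ c : G.ConnectedComponent, ∃ S : Set (Sym2 W), S.ncard ≤ 1 ∧
      ∀ (u : W) (p : G.Walk u u), p.IsCycle → G.connectedComponentMk u = c →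
        ∃ e ∈ p.edges, e ∈ S := by
    intro c
    by_cases hc : ∃ (u : W) (p : G.Walk u u), p.IsCycle ∧ G.connectedComponentMk u = c
    · obtain ⟨u, p, hp, hu⟩ := hc
      obtain ⟨e, he⟩ : ∃ e, e ∈ p.edges := by
        refine List.exists_mem_of_ne_nil _ fun hnil => hp.not_nil ?_
        rwa [SimpleGraph.Walk.edges_eq_nil] at hnil
      refine ⟨{e}, by simp, fun v q hq hv => ⟨e, ?_, rfl⟩⟩
      have := hsub u v p q hp hq (hu.trans hv.symm)
      rwa [← SimpleGraph.Walk.mem_edges_toSubgraph, ← this, SimpleGraph.Walk.mem_edges_toSubgraph]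
    · exact ⟨∅, by simp, fun v q hq hv => (hc ⟨v, q, hq, hv⟩).elim⟩
  choose S hS1 hS using hch
  set T : Set (Sym2 W) := ⋃ c, S c
  have hac : (G.deleteEdges T).IsAcyclic := by
    intro u p hp
    have hle := G.deleteEdges_le T
    obtain ⟨e, he, heS⟩ := hS _ u (p.mapLe hle) (hp.mapLe hle) rfl
    have he' : e ∈ p.edges := by simpa using he
    have := p.edges_subset_edgeSet he'
    rw [SimpleGraph.edgeSet_deleteEdges] at this
    exact this.2 (Set.mem_iUnion.2 ⟨_, heS⟩)
  have h1 := hac.card_edgeSet_add_card_connectedComponent_le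
  have h2 : Nat.card G.ConnectedComponent ≤ Nat.card (G.deleteEdges T).ConnectedComponent := by
    refine Nat.card_le_card_of_surjective
      (SimpleGraph.ConnectedComponent.map (SimpleGraph.Hom.ofLE (G.deleteEdges_le T))) ?_
    intro c
    induction c using SimpleGraph.ConnectedComponent.ind with
    | h w => exact ⟨(G.deleteEdges T).connectedComponentMk w, rfl⟩
  have h3 : T.ncard ≤ Nat.card G.ConnectedComponent := by
    have := Fintype.ofFinite G.ConnectedComponent
    calc T.ncard = (⋃ c ∈ (Finset.univ : Finset G.ConnectedComponent), S c).ncard := by simp [T]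
      _ ≤ ∑ c, (S c).ncard := Finset.set_ncard_biUnion_le _ _
      _ ≤ ∑ c : G.ConnectedComponent, 1 := Finset.sum_le_sum fun c _ => hS1 c
      _ = _ := by simp
  have h4 : Nat.card G.edgeSet ≤ Nat.card (G.deleteEdges T).edgeSet + T.ncard := by
    rw [Nat.card_coe_set_eq, Nat.card_coe_set_eq, SimpleGraph.edgeSet_deleteEdges]
    exact Set.ncard_le_ncard_sdiff_add_ncard _ _
  omega

/-- A connected graph with at most as many edges as vertices has at most one cycle. -/
theorem SimpleGraph.Connected.toSubgraph_eq_of_isCycle {W : Type*} [Finite W] {G : SimpleGraph W}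
    (hG : G.Connected) (hcard : Nat.card G.edgeSet ≤ Nat.card W) {u v : W} {p : G.Walk u u}
    {q : G.Walk v v} (hp : p.IsCycle) (hq : q.IsCycle) : p.toSubgraph = q.toSubgraph := by
  have key : ∀ {u v : W} {p : G.Walk u u} {q : G.Walk v v}, p.IsCycle → q.IsCycle →
      ∀ e, e ∈ q.edges → e ∈ p.edges := by
    intro u v p q hp hq e he
    by_contra hep
    induction e using Sym2.ind with
    | h x y =>
    have hmem := q.edges_subset_edgeSet he
    -- An edge of `q` outside `p` is no bridge. Deleting it leaves a connected graph with fewer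
    -- edges than vertices, hence a tree, which still contains the cycle `p`.
    have hnb : ¬ G.IsBridge s(x, y) := fun hb =>
      (isBridge_iff_forall_cycle_notMem hmem).1 hb q hq he
    have hc := hG.connected_delete_edge_of_not_isBridge hnb
    have h1 := hc.card_vert_le_card_edgeSet_add_one
    have hpe : ∀ e ∈ p.edges, e ∈ (G.deleteEdges {s(x, y)}).edgeSet := by
      intro e hee
      rw [edgeSet_deleteEdges]
      refine ⟨p.edges_subset_edgeSet hee, ?_⟩
      rintro rfl
      exact hep hee
    have h2 : Nat.card (G.deleteEdges {s(x, y)}).edgeSet + 1 ≠ Nat.card W := fun h =>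
      (isTree_iff_connected_and_card.2 ⟨hc, h⟩).isAcyclic _ (hp.transfer hpe)
    have h3 : Nat.card (G.deleteEdges {s(x, y)}).edgeSet + 1 = Nat.card G.edgeSet := by
      rw [Nat.card_coe_set_eq, Nat.card_coe_set_eq, edgeSet_deleteEdges,
        Set.ncard_sdiff_singleton_add_one hmem]
    omega
  exact hp.toSubgraph_eq_of_edges hq fun e => ⟨key hq hp e, key hp hq e⟩

/-- If each edge is assigned to one of its ends so that each vertex receives at most one edge, then
there are at most as many edges as vertices. -/
theorem SimpleGraph.card_edgeSet_le_of_forall_adj {W : Type*} [Finite W] {G : SimpleGraph W}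
    (φ : W → W) (h : ∀ x y, G.Adj x y → φ x = y ∨ φ y = x) :
    Nat.card G.edgeSet ≤ Nat.card W := by
  rw [Nat.card_coe_set_eq, ← Set.ncard_univ]
  refine (Set.ncard_le_ncard ?_).trans (Set.ncard_image_le (f := fun x => s(x, φ x)) Set.finite_univ)
  intro e he
  induction e using Sym2.ind with
  | h x y =>
  rcases h x y he with rfl | rfl
  · exact ⟨x, trivial, rfl⟩
  · exact ⟨y, trivial, Sym2.eq_swap⟩

/-- The assignment restricts to each component, which is connected with no more edges than vertices
and so has at most one cycle. -/
theorem isSingleCycleForest_of_forall_adj {W : Type*} [Finite W] {G : SimpleGraph W}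
    (φ : W → W) (h : ∀ x y, G.Adj x y → φ x = y ∨ φ y = x) : IsSingleCycleForest G := by
  classical
  rintro c _ ⟨⟨u, p, hp, rfl⟩, hpc⟩ _ ⟨⟨v, q, hq, rfl⟩, hqc⟩
  have hcard : Nat.card (G.induce c.supp).edgeSet ≤ Nat.card c.supp := by
    refine SimpleGraph.card_edgeSet_le_of_forall_adj
      (fun x => if hx : φ x ∈ c.supp then ⟨φ x, hx⟩ else x) ?_
    rintro ⟨x, hx⟩ ⟨y, hy⟩ hxy
    rcases h x y hxy with rfl | rfl
    · left; simp [hy]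
    · right; simp [hx]
  have hcon : (G.induce c.supp).Connected := c.connected_toSimpleGraph
  have hps : ∀ w ∈ p.support, w ∈ c.supp := fun w hw => hpc (by simpa using hw)
  have hqs : ∀ w ∈ q.support, w ∈ c.supp := fun w hw => hqc (by simpa using hw)
  have hp' : (p.induce c.supp hps).IsCycle := by
    apply SimpleGraph.Walk.IsCycle.of_map (f := (SimpleGraph.Embedding.induce _).toHom)
    rwa [SimpleGraph.Walk.map_induce]
  have hq' : (q.induce c.supp hqs).IsCycle := by
    apply SimpleGraph.Walk.IsCycle.of_map (f := (SimpleGraph.Embedding.induce _).toHom)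
    rwa [SimpleGraph.Walk.map_induce]
  have := congrArg (SimpleGraph.Subgraph.map (SimpleGraph.Embedding.induce c.supp).toHom)
    (hcon.toSubgraph_eq_of_isCycle hcard hp' hq')
  rwa [← SimpleGraph.Walk.toSubgraph_map, ← SimpleGraph.Walk.toSubgraph_map,
    SimpleGraph.Walk.map_induce, SimpleGraph.Walk.map_induce] at this

/-! ### The hull lies in the polytope -/

theorem convex_concavityPolytope {V : Type*} [DecidableEq V] (F : Finset (Finset V)) :
    Convex ℝ (concavityPolytope F) := by
  rintro x ⟨hx1, hx2⟩ y ⟨hy1, hy2⟩ a b ha hb hab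
  refine ⟨fun α => convex_Icc (0 : ℝ) 1 (hx1 α) (hy1 α) ha hb hab, fun U => ?_⟩
  calc _ = a * (∑ α : {α // α ∈ F} with (α.1 ∩ U).Nonempty, (((α.1 ∩ U).card : ℝ) - 1) * x α) +
        b * (∑ α : {α // α ∈ F} with (α.1 ∩ U).Nonempty, (((α.1 ∩ U).card : ℝ) - 1) * y α) := by
        rw [Finset.mul_sum, Finset.mul_sum, ← Finset.sum_add_distrib]
        refine Finset.sum_congr rfl fun α _ => ?_
        simp only [Pi.add_apply, Pi.smul_apply, smul_eq_mul]
        ring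
    _ ≤ a * U.card + b * U.card :=
        add_le_add (mul_le_mul_of_nonneg_left (hx2 U) ha) (mul_le_mul_of_nonneg_left (hy2 U) hb)
    _ = U.card := by rw [← add_mul, hab, one_mul]

/-- In a single-cycle forest, the incidences between vertices in `U` and a family `B` of hyperedges
number at most `|U| + |B|`. -/
theorem sum_card_inter_le_of_isSingleCycleForest {V : Type*} [Fintype V] [DecidableEq V]
    {F F' : Finset (Finset V)} (hF' : F' ⊆ F)
    (h : IsSingleCycleForest ((regionGraph (betheRegions F)).induce
      {r | r.1 ∈ F' ∪ regionNbhdSet (betheRegions F) F'}))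
    (U : Finset V) {B : Finset (Finset V)} (hB : B ⊆ F') (hB2 : ∀ α ∈ B, 2 ≤ α.card) :
    ∑ α ∈ B, (α ∩ U).card ≤ U.card + B.card := by
  classical
  have hreg : ∀ α ∈ F', α ∈ betheRegions F := fun α hα =>
    Finset.mem_union_right _ (hF' hα)
  have hsing : ∀ v : V, {v} ∈ betheRegions F := fun v =>
    Finset.mem_union_left _ (Finset.mem_image_of_mem _ (Finset.mem_univ v))
  -- Only covered vertices have their singleton in `N(F')`; the others contribute no incidence.
  let A := {v : V // v ∈ U ∧ ∃ α ∈ F', v ∈ α}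
  let f : A ⊕ {α // α ∈ B} → {r : {r // r ∈ betheRegions F} //
      r ∈ {r : {r // r ∈ betheRegions F} | r.1 ∈ F' ∪ regionNbhdSet (betheRegions F) F'}} :=
    Sum.elim
      (fun v => ⟨⟨{v.1}, hsing v.1⟩, by
        obtain ⟨α, hα, hv⟩ := v.2.2
        refine Finset.mem_union_right _ (Finset.mem_biUnion.2 ⟨α, hα, ?_⟩)
        exact Finset.mem_filter.2 ⟨hsing v.1, Or.inr (Finset.singleton_subset_iff.2 hv)⟩⟩)
      (fun α => ⟨⟨α.1, hreg _ (hB α.2)⟩, Finset.mem_union_left _ (hB α.2)⟩)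
  have hf : Function.Injective f := by
    rintro (v | α) (w | β) hvw
    · have : ({v.1} : Finset V) = {w.1} := congrArg (fun r => r.1.1) hvw
      exact congrArg Sum.inl (Subtype.ext (Finset.singleton_injective this))
    · have : ({v.1} : Finset V) = β.1 := congrArg (fun r => r.1.1) hvw
      have h2 := hB2 _ β.2
      rw [← this, Finset.card_singleton] at h2
      omega
    · have : α.1 = ({w.1} : Finset V) := congrArg (fun r => r.1.1) hvw
      have h2 := hB2 _ α.2
      rw [this, Finset.card_singleton] at h2
      omega
    · exact congrArg Sum.inr (Subtype.ext (congrArg (fun r => r.1.1) hvw))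
  have hE := (h.comap (SimpleGraph.Embedding.comap ⟨f, hf⟩ _).toHom hf).card_edgeSet_le
  set G' := ((regionGraph (betheRegions F)).induce
      {r | r.1 ∈ F' ∪ regionNbhdSet (betheRegions F) F'}).comap (⟨f, hf⟩ : _ ↪ _)
  have hadj : ∀ (v : A) (α : {α // α ∈ B}), v.1 ∈ α.1 → G'.Adj (Sum.inl v) (Sum.inr α) := by
    intro v α hv
    left
    change ({v.1} : Finset V) ⊂ α.1
    refine (Finset.singleton_subset_iff.2 hv).ssubset_of_ne fun heq => ?_
    have h2 := hB2 _ α.2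
    rw [← heq, Finset.card_singleton] at h2
    omega
  let e : (Σ α : {α // α ∈ B}, {v // v ∈ α.1 ∩ U}) → G'.edgeSet := fun x =>
    ⟨s(Sum.inl ⟨x.2.1, (Finset.mem_inter.1 x.2.2).2, x.1.1, hB x.1.2,
      (Finset.mem_inter.1 x.2.2).1⟩, Sum.inr x.1), hadj _ _ (Finset.mem_inter.1 x.2.2).1⟩
  have he : Function.Injective e := by
    rintro ⟨α, v⟩ ⟨β, w⟩ hxy
    have := congrArg Subtype.val hxy
    simp only [e, Sym2.eq_iff, Sum.inl.injEq, Sum.inr.injEq, reduceCtorEq,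
      and_self, or_false] at this
    obtain ⟨hvw, rfl⟩ := this
    rw [Sigma.mk.injEq]
    exact ⟨rfl, heq_of_eq (Subtype.ext (congrArg (fun r : A => r.1) hvw))⟩
  have h1 := Nat.card_le_card_of_injective e he
  have h2 : Nat.card A ≤ U.card := by
    rw [← Fintype.card_coe U, ← Nat.card_eq_fintype_card]
    exact Nat.card_le_card_of_injective (fun v : A => (⟨v.1, v.2.1⟩ : {v // v ∈ U}))
      fun v w hvw => Subtype.ext (congrArg (fun r : {v // v ∈ U} => r.1) hvw)
  have h3 : Nat.card (Σ α : {α // α ∈ B}, {v // v ∈ α.1 ∩ U}) = ∑ α ∈ B, (α ∩ U).card := by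
    rw [Nat.card_eq_fintype_card, Fintype.card_sigma, ← Finset.sum_coe_sort B]
    exact Finset.sum_congr rfl fun α _ => Fintype.card_coe _
  rw [Nat.card_sum, Nat.card_eq_fintype_card (α := {α // α ∈ B}), Fintype.card_coe] at hE
  omega

theorem singleCycleForestVectors_subset_concavityPolytope {V : Type*} [Fintype V] [DecidableEq V]
    (F : Finset (Finset V)) : singleCycleForestVectors F ⊆ concavityPolytope F := by
  rintro _ ⟨F', hF', h, rfl⟩
  refine ⟨fun α => ?_, fun U => ?_⟩
  · rw [hyperedgeIndicator]
    split_ifs <;> simp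
  -- One-element hyperedges coincide with singleton regions and would be counted twice; they can be
  -- dropped because their coefficient is 0.
  · set B := F'.filter fun α => 2 ≤ α.card ∧ (α ∩ U).Nonempty
    have key := sum_card_inter_le_of_isSingleCycleForest hF' h U (B := B)
      (Finset.filter_subset _ _) fun α hα => (Finset.mem_filter.1 hα).2.1
    have key' : ∑ α ∈ B, ((α ∩ U).card : ℝ) ≤ U.card + B.card := by exact_mod_cast key
    have hsum : ∑ α : {α // α ∈ F} with (α.1 ∩ U).Nonempty,
        (((α.1 ∩ U).card : ℝ) - 1) * hyperedgeIndicator F F' α =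
        ∑ α ∈ B, (((α ∩ U).card : ℝ) - 1) := by
      rw [Finset.sum_filter]
      simp only [hyperedgeIndicator]
      rw [Finset.sum_coe_sort F (fun α => if (α ∩ U).Nonempty then
        (((α ∩ U).card : ℝ) - 1) * (if α ∈ F' then 1 else 0) else 0)]
      rw [← Finset.sum_subset ((Finset.filter_subset _ _).trans hF' : B ⊆ F)]
      · refine Finset.sum_congr rfl fun α hα => ?_
        rw [Finset.mem_filter] at hα
        simp [hα.1, hα.2.2]
      · intro α _ hα
        by_cases hne : (α ∩ U).Nonempty
        · by_cases hα' : α ∈ F'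
          · have hlt : ¬ 2 ≤ α.card := fun h2 => hα (Finset.mem_filter.2 ⟨hα', h2, hne⟩)
            have h1 := hne.card_pos
            have h2 := Finset.card_le_card (Finset.inter_subset_left : α ∩ U ⊆ α)
            have h3 : (α ∩ U).card = 1 := by omega
            simp [h3]
          · simp [hα']
        · simp [hne]
    rw [hsum, Finset.sum_sub_distrib]
    simp only [Finset.sum_const, nsmul_eq_mul, mul_one]
    linarith

/-! ### Graphs: the polytope lies in the hull -/

/-- A set of edges having distinct representatives among its ends is a single-cycle forest. -/
theorem hyperedgeIndicator_mem_of_injOn {V : Type*} [Fintype V] [DecidableEq V]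
    {F F' : Finset (Finset V)} (hF : ∀ α ∈ F, α.card = 2) (hF' : F' ⊆ F) (g : Finset V → V)
    (hg : ∀ α ∈ F', g α ∈ α) (hinj : Set.InjOn g F') :
    hyperedgeIndicator F F' ∈ singleCycleForestVectors F := by
  classical
  refine ⟨F', hF', ?_, rfl⟩
  have hsing : ∀ v : V, {v} ∈ betheRegions F := fun v =>
    Finset.mem_union_left _ (Finset.mem_image_of_mem _ (Finset.mem_univ v))
  have hW : ∀ r ∈ betheRegions F, r ∈ F' ∪ regionNbhdSet (betheRegions F) F' →
      r ∈ F' ∨ r.card = 1 := by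
    intro r hr h
    rcases Finset.mem_union.1 h with h | h
    · exact Or.inl h
    obtain ⟨α, hα, h⟩ := Finset.mem_biUnion.1 h
    have hcα := hF α (hF' hα)
    rcases Finset.mem_union.1 hr with hr | hr
    · obtain ⟨v, -, rfl⟩ := Finset.mem_image.1 hr
      exact Or.inr (Finset.card_singleton v)
    · have hcr := hF r hr
      left
      rcases (Finset.mem_filter.1 h).2 with h | h
      · rwa [← Finset.eq_of_subset_of_card_le h (by omega)]
      · rwa [Finset.eq_of_subset_of_card_le h (by omega)]
  let S : Set {r // r ∈ betheRegions F} :=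
    {r | r.1 ∈ F' ∪ regionNbhdSet (betheRegions F) F'}
  -- An edge α is assigned its incidence with the end other than `g α`, while the singleton `{g α}`
  -- takes the remaining incidence with α. Injectivity of `g` makes this consistent.
  have hφ : ∀ r : S, ∃ s : S, (r.1.1 ∈ F' → s.1.1 = r.1.1.erase (g r.1.1)) ∧
      (r.1.1 ∉ F' → ∀ α ∈ F', {g α} = r.1.1 → s.1.1 = α) := by
    intro r
    by_cases hr : r.1.1 ∈ F'
    · have hc : (r.1.1.erase (g r.1.1)).card = 1 := by
        rw [Finset.card_erase_of_mem (hg _ hr), hF _ (hF' hr)]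
      obtain ⟨v, hv⟩ := Finset.card_eq_one.1 hc
      refine ⟨⟨⟨{v}, hsing v⟩, ?_⟩, fun _ => hv.symm, fun h => (h hr).elim⟩
      refine Finset.mem_union_right _ (Finset.mem_biUnion.2 ⟨r.1.1, hr, ?_⟩)
      refine Finset.mem_filter.2 ⟨hsing v, Or.inr ?_⟩
      exact hv.symm.subset.trans (Finset.erase_subset _ _)
    · by_cases hα : ∃ α ∈ F', {g α} = r.1.1
      · obtain ⟨α, hα, hαr⟩ := hα
        refine ⟨⟨⟨α, Finset.mem_union_right _ (hF' hα)⟩, Finset.mem_union_left _ hα⟩,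
          fun h => (hr h).elim, fun _ β hβ hβr => hinj hα hβ ?_⟩
        exact Finset.singleton_injective (hαr.trans hβr.symm)
      · exact ⟨r, fun h => (hr h).elim, fun _ α h1 h2 => (hα ⟨α, h1, h2⟩).elim⟩
  choose φ hφ1 hφ2 using hφ
  have key : ∀ x y : S, x.1.1 ⊂ y.1.1 → φ x = y ∨ φ y = x := by
    intro x y hxy
    have hlt := Finset.card_lt_card hxy
    have hxW := hW _ x.1.2 x.2
    have hyW := hW _ y.1.2 y.2
    have hx2 : x.1.1 ∈ F' → x.1.1.card = 2 := fun h => hF _ (hF' h)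
    have hy2 : y.1.1 ∈ F' → y.1.1.card = 2 := fun h => hF _ (hF' h)
    have hyF : y.1.1 ∈ F' := hyW.resolve_right fun h => by
      rcases hxW with h' | h'
      · have := hx2 h'; omega
      · omega
    have hxc : x.1.1.card = 1 := hxW.resolve_left fun h => by
      have := hx2 h; have := hy2 hyF; omega
    have hxF : x.1.1 ∉ F' := fun h => by have := hx2 h; omega
    obtain ⟨v, hv⟩ := Finset.card_eq_one.1 hxc
    have hvy : v ∈ y.1.1 := hxy.1 (by simp [hv])
    by_cases hvg : g y.1.1 = v
    · left
      exact Subtype.ext (Subtype.ext (hφ2 x hxF _ hyF (by rw [hvg, hv])))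
    · right
      refine Subtype.ext (Subtype.ext ?_)
      rw [hφ1 y hyF, hv]
      symm
      apply Finset.eq_of_subset_of_card_le
      · simpa using ⟨fun h => hvg h.symm, hvy⟩
      · rw [Finset.card_erase_of_mem (hg _ hyF), hy2 hyF]
        simp
  refine isSingleCycleForest_of_forall_adj φ fun x y hxy => ?_
  rcases hxy with h | h
  · exact key x y h
  · exact (key y x h).symm

/-- The row sums of a doubly substochastic matrix supported on the incidences of a graph form a
convex combination of indicators of single-cycle forests. -/
theorem rowSum_mem_convexHull_singleCycleForestVectors {V : Type*} [Fintype V] [DecidableEq V]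
    {F : Finset (Finset V)} (hF : ∀ α ∈ F, α.card = 2) (y : {α // α ∈ F} → V → ℝ)
    (hy0 : ∀ α v, 0 ≤ y α v) (hsupp : ∀ α v, v ∉ α.1 → y α v = 0)
    (hrow : ∀ α, ∑ v, y α v ≤ 1) (hcol : ∀ v, ∑ α, y α v ≤ 1) :
    (fun α => ∑ v, y α v) ∈ convexHull ℝ (singleCycleForestVectors F) := by
  classical
  -- The diagonal blocks carry the row and column deficits, so the symmetric matrix has all line
  -- sums 1.
  let M : Matrix ({α // α ∈ F} ⊕ V) ({α // α ∈ F} ⊕ V) ℝ :=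
    Matrix.fromBlocks (Matrix.diagonal fun α => 1 - ∑ v, y α v) (Matrix.of y)
      (Matrix.of y).transpose (Matrix.diagonal fun v => 1 - ∑ α, y α v)
  have hM : M ∈ doublyStochastic ℝ ({α // α ∈ F} ⊕ V) := by
    rw [mem_doublyStochastic_iff_sum]
    refine ⟨?_, ?_, ?_⟩
    · rintro (α | v) (β | w)
      · simp only [M, Matrix.fromBlocks_apply₁₁, Matrix.diagonal_apply]
        split_ifs
        · exact sub_nonneg.2 (hrow α)
        · exact le_rfl
      · exact hy0 α w
      · exact hy0 β v
      · simp only [M, Matrix.fromBlocks_apply₂₂, Matrix.diagonal_apply]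
        split_ifs
        · exact sub_nonneg.2 (hcol v)
        · exact le_rfl
    · rintro (α | v) <;> simp [M, Matrix.diagonal_apply]
    · rintro (α | v) <;> simp [M, Matrix.diagonal_apply]
  obtain ⟨w, hw0, hw1, hwM⟩ := exists_eq_sum_perm_of_mem_doublyStochastic hM
  let F' : Equiv.Perm ({α // α ∈ F} ⊕ V) → Finset (Finset V) := fun σ =>
    F.filter fun α => ∃ hα : α ∈ F, ∃ v ∈ α, σ (Sum.inl ⟨α, hα⟩) = Sum.inr v
  refine mem_convexHull_of_exists_fintype w (fun σ => hyperedgeIndicator F (F' σ)) hw0 hw1 ?_ ?_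
  · intro σ
    have hex : ∀ α ∈ F' σ, ∃ v ∈ α, ∃ hα : α ∈ F, σ (Sum.inl ⟨α, hα⟩) = Sum.inr v := by
      intro α hα
      obtain ⟨-, h, v, hv, hσ⟩ := Finset.mem_filter.1 hα
      exact ⟨v, hv, h, hσ⟩
    -- `V` may be empty, in which case no representative function exists.
    rcases (F' σ).eq_empty_or_nonempty with hemp | ⟨α₀, hα₀⟩
    · rw [hemp]
      refine ⟨∅, Finset.empty_subset _, ?_, rfl⟩
      rintro c
      induction c using SimpleGraph.ConnectedComponent.ind with
      | h r => exact (by simpa [regionNbhdSet] using r.2 : False).elim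
    · have : Nonempty V := ⟨(hex α₀ hα₀).choose⟩
      choose! g hg1 hg2 using hex
      refine hyperedgeIndicator_mem_of_injOn hF (Finset.filter_subset _ _) g hg1 ?_
      intro α hα β hβ hαβ
      obtain ⟨h1, h1'⟩ := hg2 α hα
      obtain ⟨h2, h2'⟩ := hg2 β hβ
      rw [← hαβ, ← h1'] at h2'
      simpa using (σ.injective h2').symm
  · ext α
    have hsum : ∑ v, y α v = ∑ v ∈ α.1, y α v :=
      (Finset.sum_subset (Finset.subset_univ _) fun v _ hv => hsupp α v hv).symm
    have hent : ∀ v, y α v = ∑ σ, w σ * (if σ (Sum.inl α) = Sum.inr v then 1 else 0) := by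
      intro v
      have := congrFun (congrFun hwM (Sum.inl α)) (Sum.inr v)
      rw [show M (Sum.inl α) (Sum.inr v) = y α v from rfl] at this
      rw [← this, Matrix.sum_apply]
      refine Finset.sum_congr rfl fun σ _ => ?_
      simp [PEquiv.toMatrix_apply, Equiv.toPEquiv_apply]
    rw [hsum, Finset.sum_congr rfl fun v _ => hent v, Finset.sum_comm, Finset.sum_apply]
    refine Finset.sum_congr rfl fun σ _ => ?_
    rw [← Finset.mul_sum, Pi.smul_apply, smul_eq_mul]
    congr 1
    by_cases h : ∃ v ∈ α.1, σ (Sum.inl α) = Sum.inr v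
    · have hmem : α.1 ∈ F' σ := Finset.mem_filter.2 ⟨α.2, α.2, h⟩
      obtain ⟨v, hv, hσ⟩ := h
      simp [hyperedgeIndicator, hmem, hσ, hv]
    · have hmem : α.1 ∉ F' σ := fun hm => by
        obtain ⟨-, _, h'⟩ := Finset.mem_filter.1 hm
        exact h h'
      push Not at h
      rw [hyperedgeIndicator, if_neg hmem]
      exact (Finset.sum_eq_zero fun v hv => if_neg (h v hv)).symm

theorem finite_singleCycleForestVectors {V : Type*} [Fintype V] [DecidableEq V]
    (F : Finset (Finset V)) : (singleCycleForestVectors F).Finite := by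
  refine (F.powerset.finite_toSet.image (hyperedgeIndicator F)).subset ?_
  rintro _ ⟨F', hF', -, rfl⟩
  exact ⟨F', by simpa using hF', rfl⟩

/-- In the concavity polytope of a graph, the weight of a set of edges is at most the number of
vertices that it covers. -/
theorem sum_le_card_biUnion_of_mem_concavityPolytope {V : Type*} [DecidableEq V]
    {F : Finset (Finset V)} (hF : ∀ α ∈ F, α.card = 2) {ρ : {α // α ∈ F} → ℝ}
    (hρ : ρ ∈ concavityPolytope F) (B : Finset {α // α ∈ F}) :
    ∑ α ∈ B, ρ α ≤ ((B.biUnion fun α => α.1).card : ℝ) := by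
  refine le_trans ?_ (hρ.2 (B.biUnion fun α => α.1))
  have hin : ∀ α ∈ B, α.1 ∩ B.biUnion (fun α => α.1) = α.1 := fun α hα =>
    Finset.inter_eq_left.2 (Finset.subset_biUnion_of_mem (fun α : {α // α ∈ F} => α.1) hα)
  calc ∑ α ∈ B, ρ α
      = ∑ α ∈ B, (((α.1 ∩ B.biUnion fun α => α.1).card : ℝ) - 1) * ρ α := by
        refine Finset.sum_congr rfl fun α hα => ?_
        rw [hin α hα, hF _ α.2]
        norm_num
    _ ≤ _ := by
        refine Finset.sum_le_sum_of_subset_of_nonneg ?_ ?_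
        · intro α hα
          rw [Finset.mem_filter, hin α hα, ← Finset.card_pos, hF _ α.2]
          simp
        · intro α hα _
          have h1 : (1 : ℝ) ≤ ((α.1 ∩ B.biUnion fun α => α.1).card : ℝ) := by
            exact_mod_cast (Finset.mem_filter.1 hα).2.card_pos
          exact mul_nonneg (by linarith) (hρ.1 α).1

/-- Rounding down keeps the Hall condition and makes the weights multiples of 1/N, so an integral
matching can produce the fractional splitting. -/
theorem floor_div_mem_convexHull_singleCycleForestVectors {V : Type*} [Fintype V] [DecidableEq V]
    {F : Finset (Finset V)} (hF : ∀ α ∈ F, α.card = 2) {ρ : {α // α ∈ F} → ℝ}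
    (hρ : ρ ∈ concavityPolytope F) {N : ℕ} (hN : 0 < N) :
    (fun α => (⌊ρ α * N⌋₊ : ℝ) / N) ∈ convexHull ℝ (singleCycleForestVectors F) := by
  classical
  have hNpos : (0 : ℝ) < N := by exact_mod_cast hN
  let k : {α // α ∈ F} → ℕ := fun α => ⌊ρ α * N⌋₊
  have hk : ∀ α, (k α : ℝ) ≤ ρ α * N := fun α =>
    Nat.floor_le (mul_nonneg (hρ.1 α).1 hNpos.le)
  -- Each of the `k α` copies of α is to be matched to one of the `N` copies of one of its ends.
  let t : (Σ α : {α // α ∈ F}, Fin (k α)) → Finset (V × Fin N) := fun x =>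
    x.1.1 ×ˢ Finset.univ
  have hall : ∀ s : Finset (Σ α : {α // α ∈ F}, Fin (k α)), s.card ≤ (s.biUnion t).card := by
    intro s
    set B := s.image Sigma.fst
    have h1 : s.card ≤ ∑ α ∈ B, k α := by
      calc s.card ≤ (B.sigma fun α => (Finset.univ : Finset (Fin (k α)))).card := by
            refine Finset.card_le_card fun x hx => ?_
            exact Finset.mem_sigma.2 ⟨Finset.mem_image_of_mem _ hx, Finset.mem_univ _⟩
        _ = _ := by simp
    have h2 : s.biUnion t = (B.biUnion fun α => α.1) ×ˢ (Finset.univ : Finset (Fin N)) := by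
      ext ⟨v, i⟩
      simp [t, B]
    rw [h2, Finset.card_product, Finset.card_univ, Fintype.card_fin]
    have h3 : ((∑ α ∈ B, k α : ℕ) : ℝ) ≤ ((B.biUnion fun α => α.1).card * N : ℕ) := by
      push_cast
      calc ∑ α ∈ B, (k α : ℝ) ≤ ∑ α ∈ B, ρ α * N := Finset.sum_le_sum fun α _ => hk α
        _ = (∑ α ∈ B, ρ α) * N := by rw [Finset.sum_mul]
        _ ≤ _ := mul_le_mul_of_nonneg_right
          (sum_le_card_biUnion_of_mem_concavityPolytope hF hρ B) hNpos.le
    exact h1.trans (by exact_mod_cast h3)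
  obtain ⟨f, hf, hft⟩ := (Finset.all_card_le_biUnion_card_iff_exists_injective t).1 hall
  -- The share of α given to `v` is the number of copies of α matched to copies of `v`, over `N`; as
  -- `v` has only `N` copies, column sums are at most 1.
  let y : {α // α ∈ F} → V → ℝ := fun α v =>
    ((Finset.univ.filter fun i : Fin (k α) => (f ⟨α, i⟩).1 = v).card : ℝ) / N
  have hrow : ∀ α, ∑ v, y α v = (k α : ℝ) / N := by
    intro α
    rw [← Finset.sum_div, ← Nat.cast_sum, ← Finset.card_eq_sum_card_fiberwise (by simp)]
    simp
  have hcol : ∀ v, ∑ α, y α v ≤ 1 := by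
    intro v
    rw [← Finset.sum_div, div_le_one hNpos, ← Nat.cast_sum, Nat.cast_le]
    rw [← Finset.card_sigma]
    calc _ ≤ (Finset.univ : Finset (Fin N)).card := by
          refine Finset.card_le_card_of_injOn (fun x => (f x).2) (by simp) ?_
          rintro ⟨α, i⟩ hx ⟨β, j⟩ hx' hij
          simp only [Finset.coe_sigma, Set.mem_sigma_iff, Finset.coe_filter, Set.mem_ofPred_eq,
            Finset.mem_univ, true_and, Finset.coe_univ, Set.mem_univ] at hx hx'
          exact hf (Prod.ext (hx.trans hx'.symm) hij)
      _ = N := by simp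
  have := rowSum_mem_convexHull_singleCycleForestVectors hF y (fun α v => by positivity) ?_ ?_ hcol
  · simpa only [hrow] using this
  · intro α v hv
    have : (Finset.univ.filter fun i : Fin (k α) => (f ⟨α, i⟩).1 = v) = ∅ := by
      refine Finset.filter_eq_empty_iff.2 fun i _ h => hv ?_
      rw [← h]
      exact (Finset.mem_product.1 (hft ⟨α, i⟩)).1
    simp [y, this]
  · intro α
    rw [hrow, div_le_one hNpos]
    exact (hk α).trans (mul_le_of_le_one_left hNpos.le (hρ.1 α).2)

theorem concavityPolytope_subset_convexHull {V : Type*} [Fintype V] [DecidableEq V]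
    {F : Finset (Finset V)} (hF : ∀ α ∈ F, α.card = 2) :
    concavityPolytope F ⊆ convexHull ℝ (singleCycleForestVectors F) := by
  intro ρ hρ
  have hlim : Filter.Tendsto (fun (N : ℕ) (α : {α // α ∈ F}) => (⌊ρ α * N⌋₊ : ℝ) / N)
      Filter.atTop (nhds ρ) :=
    tendsto_pi_nhds.2 fun α =>
      (tendsto_nat_floor_mul_div_atTop (hρ.1 α).1).comp tendsto_natCast_atTop_atTop
  refine ((finite_singleCycleForestVectors F).isClosed_convexHull ℝ).mem_of_tendsto hlim ?_
  filter_upwards [Filter.eventually_gt_atTop 0] with N hN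
  exact floor_div_mem_convexHull_singleCycleForestVectors hF hρ hN

theorem mainTheorem4 {V : Type*} [Fintype V] [DecidableEq V] (F : Finset (Finset V))
    (hBethe : IsBethe F) :
    convexHull ℝ (singleCycleForestVectors F) ⊆ concavityPolytope F ∧
    ((∀ α ∈ F, α.card = 2) →
      convexHull ℝ (singleCycleForestVectors F) = concavityPolytope F) := by
  have h := convexHull_min (singleCycleForestVectors_subset_concavityPolytope F)
    (convex_concavityPolytope F)
  exact ⟨h, fun hF => h.antisymm (concavityPolytope_subset_convexHull hF)⟩
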